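/- Let $R\in\mathbb{R}^{n\times n}$ be an entrywise nonnegative matrix with Perron–Frobenius (PF) eigenvalue $1$, i.e. $1$ is an eigenvalue of $R$ and every complex eigenvalue $\mu$ of $R$ satisfies $|\mu|\le 1$. List the eigenvalues of $R$ with algebraic multiplicity and remove one copy of the eigenvalue $1$; let $\lambda_2(R)$ be one of the remaining eigenvalues with the largest real part (so $n\ge 2$). Define the edge expansion $\phi(R)$ as follows. If $R$ does not have everywhere positive left and right eigenvectors for the eigenvalue $1$, then $\phi(R)=0$. Otherwise let $x,y$ be any everywhere positive left and right eigenvectors of $R$ for the eigenvalue $1$, normalized so that $\langle x,y\rangle=1$, and put $$\phi(R)=\min_{\emptyset\neq S\subseteq[n],\ \sum_{i\in S}x_iy_i\le\frac12}\ \frac{\sum_{i\in S,\,j\notin S}R_{i,j}\,x_i\,y_j}{\sum_{i\in S}x_iy_i}$$ (the value does not depend on the choice of $x,y$). Let $u$ and $v$ be any left and right eigenvectors of $R$ for the eigenvalue $1$, let $\kappa=\min_i u_iv_i$, and if $\kappa>0$ let $u$ and $v$ be normalized so that $\langle u,v\rangle=1$. Then $$0\le\phi(R)\le\sqrt{2\,(1-\operatorname{Re}\lambda_2(R))},$$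 and if $\kappa>0$ then also $$\frac1{30}\cdot\frac{1-\operatorname{Re}\lambda_2(R)}{n+\ln(1/\kappa)}\le\phi(R).$$ -/

import Mathlib

namespace NonnegMatrix

open scoped Matrix

/-- The multiset of complex eigenvalues of a real square matrix, with algebraic multiplicity. -/
noncomputable def eigenvalues {n : ℕ} (R : Matrix (Fin n) (Fin n) ℝ) : Multiset ℂ :=
  (R.map (algebraMap ℝ ℂ)).charpoly.roots

/-- `r` is the Perron-Frobenius eigenvalue of `R`: it is an eigenvalue of `R` that is largest in
magnitude amongst all complex eigenvalues. -/
def IsPFEigenvalue {n : ℕ} (R : Matrix (Fin n) (Fin n) ℝ) (r : ℝ) : Prop :=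
  0 ≤ r ∧ (r : ℂ) ∈ eigenvalues R ∧ ∀ μ ∈ eigenvalues R, ‖μ‖ ≤ r

/-- `u` is a left eigenvector of `R` for the eigenvalue `r`. -/
def IsLeftEigenvector {n : ℕ} (R : Matrix (Fin n) (Fin n) ℝ) (r : ℝ) (u : Fin n → ℝ) : Prop :=
  u ≠ 0 ∧ u ᵥ* R = r • u

/-- `v` is a right eigenvector of `R` for the eigenvalue `r`. -/
def IsRightEigenvector {n : ℕ} (R : Matrix (Fin n) (Fin n) ℝ) (r : ℝ) (v : Fin n → ℝ) : Prop :=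
  v ≠ 0 ∧ R *ᵥ v = r • v

/-- For a matrix `R` with PF eigenvalue `1`: `z` is a second eigenvalue of `R`, that is, an
eigenvalue of maximum real part among the nontrivial eigenvalues, which are those left in the
multiset of eigenvalues after one copy of the trivial eigenvalue `1` is removed. Several `z` can
qualify, but all of them have the same real part. -/
def IsSecondEigenvalue {n : ℕ} (R : Matrix (Fin n) (Fin n) ℝ) (z : ℂ) : Prop :=
  z ∈ (eigenvalues R).erase 1 ∧ ∀ μ ∈ (eigenvalues R).erase 1, μ.re ≤ z.re

/-- `u` and `v` are everywhere positive left and right eigenvectors of `R` for the eigenvalue `1`,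
normalized so that their inner product is `1`. -/
def IsPositivePair {n : ℕ} (R : Matrix (Fin n) (Fin n) ℝ) (u v : Fin n → ℝ) : Prop :=
  IsLeftEigenvector R 1 u ∧ IsRightEigenvector R 1 v ∧
    (∀ i, 0 < u i) ∧ (∀ i, 0 < v i) ∧ u ⬝ᵥ v = 1

/-- The cuts over which the edge expansion is minimized: nonempty sets of indices of weight at
most one half. -/
def IsSmallCut {n : ℕ} (u v : Fin n → ℝ) (S : Finset (Fin n)) : Prop :=
  S.Nonempty ∧ ∑ i ∈ S, u i * v i ≤ 1 / 2

/-- The edge expansion of the cut `S`, computed from the eigenvectors `u` and `v`. -/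
noncomputable def cutExpansion {n : ℕ} (R : Matrix (Fin n) (Fin n) ℝ) (u v : Fin n → ℝ)
    (S : Finset (Fin n)) : ℝ :=
  (∑ i ∈ S, ∑ j ∈ Sᶜ, R i j * u i * v j) / ∑ i ∈ S, u i * v i

open Classical in
/-- The edge expansion of a nonnegative matrix `R` with PF eigenvalue `1`. It is `0` if `R` has no
everywhere positive left and right eigenvectors for the eigenvalue `1`. Otherwise some normalized
positive pair is chosen and the expansion is minimized over the finitely many small cuts (there is
one as soon as `2 ≤ n`); the value does not depend on the choice. -/
noncomputable def edgeExpansion {n : ℕ} (R : Matrix (Fin n) (Fin n) ℝ) : ℝ :=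
  if h : ∃ p : (Fin n → ℝ) × (Fin n → ℝ), IsPositivePair R p.1 p.2 then
    ⨅ S : {S : Finset (Fin n) // IsSmallCut h.choose.1 h.choose.2 S},
      cutExpansion R h.choose.1 h.choose.2 S
  else 0

end NonnegMatrix

namespace NonnegMatrix

open scoped Matrix
open Polynomial

/-! Positive left and right eigenvectors `x`, `y` conjugate `R` to a stochastic matrix
`stochasticConj R y` with the same eigenvalues and stationary distribution `w i = x i * y i`; cut
expansions of `R` become escape probabilities under `w`. Both bounds hold for whichever pair is
chosen, so independence of the choice never enters.

Upper bound (`sq_expansion_le_of_stochastic`): a nontrivial eigenvalue `μ` has an eigenvector of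
`w`-mean zero (`exists_eigenvector_mem_ker`). Cheeger's inequality in the form
`sq_expansion_mul_variance_le` needs the flow's row and column sums but no reversibility, so it
applies to the real and imaginary parts of that eigenvector; their energies add up to `2 * (1 -
μ.re)` times the squared norm.

Lower bound (`spectral_gap_mul_le_expansion`): for the lazy walk `(1 + P) / 2` with gap `δ`, about
`6 / δ` steps bring every nontrivial eigenvalue to modulus at most `1/4`. Since `P` need not be
normal, this does not bound the norm by itself; but a contraction annihilated by `n - 1` such
factors does decay after `O(n)` further powers (`seminorm_pow_le_of_prod_eq_zero`). So after `K =
O(n / δ)` steps the centred indicator of `S` is nearly uncorrelated with its start, whereas each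
step removes at most half the flow out of `S` from the mass in `S` (`le_sum_lazyStep_indicator`).
The flow is therefore at least of order `δ / n` times the mass of `S`. This is stronger than the
claim: the logarithm is nonnegative and only weakens the bound.

The given `u`, `v` are not assumed positive. If the second eigenvalue has real part below `1`, lazy
powers of `R` converge to the rank-one projection with entries `v i * u j`, which is thus
nonnegative (`mul_nonneg_of_simple`); with `u i * v i > 0` this makes `u`, `v` positive up to a
common sign. If the real part is `1`, the lower bound is zero. -/

/-! ### Annihilating polynomials and decay of operator powers -/

/-- If a product of factors `T - μ` with `‖μ‖ ≤ b` kills `f`, then the iterates `T ^ k f` decay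
geometrically, with a constant exponential in the number of factors. -/
theorem seminorm_pow_le_of_prod_eq_zero {V : Type*} [AddCommGroup V] [Module ℂ V]
    (p : Seminorm ℂ V) (T : Module.End ℂ V) {b r C D : ℝ} (hb : 0 ≤ b) (hr : 0 ≤ r)
    (hD : 1 ≤ D) (hT : ∀ x, p (T x) ≤ C * p x) (hDr : b * D + (C + b) ≤ D * r)
    (l : List ℂ) (hl : ∀ μ ∈ l, ‖μ‖ ≤ b) (f : V)
    (hf : (l.map fun μ => T - algebraMap ℂ (Module.End ℂ V) μ).prod f = 0) (k : ℕ) :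
    p ((T ^ k) f) ≤ D ^ l.length * r ^ k * p f := by
  induction l generalizing f k with
  | nil =>
    have hf0 : f = 0 := by simpa using hf
    simp [hf0]
  | cons μ l ih =>
    have hμ : ‖μ‖ ≤ b := hl μ (by simp)
    have hcomm : ∀ l : List ℂ,
        Commute (T - algebraMap ℂ (Module.End ℂ V) μ)
          ((l.map fun μ => T - algebraMap ℂ (Module.End ℂ V) μ).prod) := by
      intro l
      apply Commute.list_prod_right
      intro x hx
      obtain ⟨ν, -, rfl⟩ := List.mem_map.1 hx
      exact ((Commute.refl T).sub_right (Algebra.commutes ν T).symm).sub_left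
        (Algebra.commutes μ _)
    -- The remaining factors kill `f'`, so the outer hypothesis bounds `T ^ k f'`. The recursion `T
    -- ^ (k + 1) f = μ • T ^ k f + T ^ k f'` then closes by `hDr`, at the price of one factor `D`
    -- per eigenvalue.
    set f' : V := (T - algebraMap ℂ (Module.End ℂ V) μ) f with hf'
    have hTf : T f = μ • f + f' := by simp [hf', Module.algebraMap_end_apply]
    have hann : (l.map fun μ => T - algebraMap ℂ (Module.End ℂ V) μ).prod f' = 0 := by
      rw [hf', ← Module.End.mul_apply, ← (hcomm l).eq]
      simpa using hf
    have ih' := fun k => ih (fun ν hν => hl ν (by simp [hν])) f' hann k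
    have hpf' : p f' ≤ (C + b) * p f := by
      have h1 : f' = T f - μ • f := by rw [hTf]; abel
      calc p f' ≤ p (T f) + p (μ • f) := by rw [h1]; exact map_sub_le_add p _ _
        _ ≤ C * p f + b * p f := by
          rw [map_smul_eq_mul]
          gcongr
          exact hT f
        _ = _ := by ring
    have hpf : 0 ≤ p f := apply_nonneg p f
    have hD0 : 0 ≤ D := by linarith
    induction k with
    | zero =>
      simpa using le_mul_of_one_le_left hpf (one_le_pow₀ (n := l.length + 1) hD)
    | succ k ihk =>
      have h2 : (T ^ (k + 1)) f = μ • (T ^ k) f + (T ^ k) f' := by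
        rw [pow_succ, Module.End.mul_apply, hTf, map_add, map_smul]
      calc p ((T ^ (k + 1)) f) ≤ p (μ • (T ^ k) f) + p ((T ^ k) f') := by
            rw [h2]; exact map_add_le_add p _ _
        _ ≤ b * (D ^ (μ :: l).length * r ^ k * p f) +
              D ^ l.length * r ^ k * ((C + b) * p f) := by
          rw [map_smul_eq_mul]
          refine add_le_add (mul_le_mul hμ ihk (apply_nonneg _ _) hb) ((ih' k).trans ?_)
          gcongr
        _ = D ^ l.length * r ^ k * p f * (b * D + (C + b)) := by
          rw [List.length_cons]; ring
        _ ≤ D ^ l.length * r ^ k * p f * (D * r) := by gcongr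
        _ = _ := by rw [List.length_cons]; ring

theorem prod_X_sub_C_dvd_prod_sub_C_eval (g : ℂ[X]) (l : List ℂ) :
    (l.map fun μ => X - C μ).prod ∣ (l.map fun μ => g - C (g.eval μ)).prod := by
  induction l with
  | nil => simp
  | cons μ l ih =>
    simp only [List.map_cons, List.prod_cons]
    exact mul_dvd_mul X_sub_C_dvd_sub_C_eval ih

/-- Spectral mapping for annihilating products of linear factors. -/
theorem prod_aeval_sub_apply_eq_zero {V : Type*} [AddCommGroup V] [Module ℂ V]
    (T : Module.End ℂ V) (g : ℂ[X]) (l : List ℂ) (f : V)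
    (hf : aeval T (l.map fun μ => X - C μ).prod f = 0) :
    ((l.map fun μ => g.eval μ).map fun μ =>
      aeval T g - algebraMap ℂ (Module.End ℂ V) μ).prod f = 0 := by
  have h : ((l.map fun μ => g.eval μ).map fun μ =>
      aeval T g - algebraMap ℂ (Module.End ℂ V) μ).prod =
      aeval T (l.map fun μ => g - C (g.eval μ)).prod := by
    rw [map_list_prod, List.map_map, List.map_map]
    congr 2
    ext1 μ
    simp
  obtain ⟨q, hq⟩ := prod_X_sub_C_dvd_prod_sub_C_eval g l
  rw [h, hq, mul_comm, map_mul, Module.End.mul_apply, hf, map_zero]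

theorem apply_aeval_of_invariant {V : Type*} [AddCommGroup V] [Module ℂ V]
    (T : Module.End ℂ V) (φ : V →ₗ[ℂ] ℂ) (hφ : ∀ x, φ (T x) = φ x) (q : ℂ[X]) (x : V) :
    φ (aeval T q x) = q.eval 1 * φ x := by
  induction q using Polynomial.induction_on' with
  | add p q hp hq => simp [hp, hq, add_mul]
  | monomial k a =>
    have h : ∀ k : ℕ, φ ((T ^ k) x) = φ x := by
      intro k
      induction k with
      | zero => simp
      | succ k ih => rw [pow_succ', Module.End.mul_apply, hφ, ih]
    simp [aeval_monomial, h]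

/-- If `1` is a simple eigenvalue, then the other eigenvalues annihilate the kernel of the invariant
functional. -/
theorem aeval_prod_erase_apply_eq_zero {V : Type*} [AddCommGroup V] [Module ℂ V] [FiniteDimensional ℂ V]
    (T : Module.End ℂ V) (φ : V →ₗ[ℂ] ℂ) (hφ : ∀ x, φ (T x) = φ x)
    {v : V} (hv : T v = v) (hφv : φ v ≠ 0)
    (h1 : (1 : ℂ) ∈ T.charpoly.roots) (hsimple : (1 : ℂ) ∉ T.charpoly.roots.erase 1) {f : V}
    (hf : φ f = 0) :
    aeval T ((T.charpoly.roots.erase 1).toList.map fun μ => X - C μ).prod f = 0 := by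
  set q : ℂ[X] := ((T.charpoly.roots.erase 1).toList.map fun μ => X - C μ).prod with hq
  have hfac : T.charpoly = (X - C 1) * q := by
    have h2 : q = ((T.charpoly.roots.erase 1).map fun μ => X - C μ).prod := by
      conv_rhs => rw [← Multiset.coe_toList (T.charpoly.roots.erase 1)]
      rw [Multiset.map_coe, Multiset.prod_coe]
    rw [h2, ← Multiset.prod_cons, ← Multiset.map_cons (fun μ => X - C μ), Multiset.cons_erase h1]
    exact (IsAlgClosed.splits T.charpoly).eq_prod_roots_of_monic T.charpoly_monic
  -- By Cayley–Hamilton `g` is fixed by `T`. Simplicity makes it a multiple of `v`, and `φ g = 0`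
  -- forces the multiple to be zero.
  set g := aeval T q f with hg
  have hTg : T g = g := by
    have := congrArg (fun S : Module.End ℂ V => S f) T.aeval_self_charpoly
    simp only [hfac, map_mul, Module.End.mul_apply] at this
    rw [← hg] at this
    simpa [sub_eq_zero] using this
  have hφg : φ g = 0 := by rw [hg, apply_aeval_of_invariant T φ hφ, hf, mul_zero]
  have hdim : Module.finrank ℂ (T.eigenspace 1) ≤ 1 := by
    refine (T.finrank_eigenspace_le 1).trans ?_
    rw [← count_roots]
    have := Multiset.count_eq_zero.2 hsimple
    rw [Multiset.count_erase_self] at this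
    omega
  have hvm : v ∈ T.eigenspace 1 := by simp [hv]
  have hgm : g ∈ T.eigenspace 1 := by simp [hTg]
  have hv0 : (⟨v, hvm⟩ : T.eigenspace 1) ≠ 0 := by
    intro h
    apply hφv
    rw [show v = 0 from congrArg Subtype.val h, map_zero]
  obtain ⟨c, hc⟩ := (finrank_le_one_iff.1 hdim).elim fun w hw => by
    obtain ⟨a, ha⟩ := hw ⟨v, hvm⟩
    obtain ⟨d, hd⟩ := hw ⟨g, hgm⟩
    have ha0 : a ≠ 0 := by rintro rfl; exact hv0 (by rw [← ha, zero_smul])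
    exact (⟨d / a, by rw [← ha, smul_smul, div_mul_cancel₀ _ ha0, hd]⟩ :
      ∃ c : ℂ, c • (⟨v, hvm⟩ : T.eigenspace 1) = ⟨g, hgm⟩)
  have hc' : c • v = g := congrArg Subtype.val hc
  have : c = 0 := by
    rw [← hc', map_smul, smul_eq_mul] at hφg
    exact (mul_eq_zero.1 hφg).resolve_right hφv
  rw [← hc', this, zero_smul]

/-- Every nontrivial eigenvalue has an eigenvector in the kernel of the invariant functional. -/
theorem exists_eigenvector_mem_ker {V : Type*} [AddCommGroup V] [Module ℂ V] [FiniteDimensional ℂ V]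
    (T : Module.End ℂ V) (φ : V →ₗ[ℂ] ℂ) (hφ : ∀ x, φ (T x) = φ x)
    {μ : ℂ} (hμ : μ ∈ T.charpoly.roots.erase 1) :
    ∃ z : V, z ≠ 0 ∧ φ z = 0 ∧ T z = μ • z := by
  by_cases h1 : μ = 1
  · subst h1
    have hdim : 2 ≤ Module.finrank ℂ (T.maxGenEigenspace 1) := by
      rw [T.finrank_maxGenEigenspace_eq, ← count_roots]
      have := Multiset.one_le_count_iff_mem.2 hμ
      rw [Multiset.count_erase_self] at this
      omega
    obtain ⟨w, hw, hw0⟩ : ∃ w : T.maxGenEigenspace 1,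
        w ∈ LinearMap.ker (φ.comp (T.maxGenEigenspace 1).subtype) ∧ w ≠ 0 := by
      apply Submodule.exists_mem_ne_zero_of_ne_bot
      intro hbot
      have h2 := LinearMap.finrank_range_add_finrank_ker
        (φ.comp (T.maxGenEigenspace 1).subtype)
      rw [hbot, finrank_bot] at h2
      have h3 := (LinearMap.range (φ.comp (T.maxGenEigenspace 1).subtype)).finrank_le
      rw [Module.finrank_self] at h3
      omega
    have hex : ∃ k : ℕ, ((T - 1) ^ k) (w : V) = 0 := by
      have := w.2
      rw [Module.End.mem_maxGenEigenspace] at this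
      simpa using this
    classical
    have hk := Nat.find_spec hex
    have hmin := fun m => Nat.find_min hex (m := m)
    obtain ⟨m, hm⟩ : ∃ m, Nat.find hex = m + 1 := by
      refine Nat.exists_eq_succ_of_ne_zero fun h => hw0 ?_
      rw [h] at hk
      exact Subtype.ext (by simpa using hk)
    rw [hm] at hk
    -- The last nonzero power of `T - 1` on `w` is an eigenvector. It lies in the kernel of `φ`
    -- because `w` does (`m = 0`) or because `φ` vanishes on the range of `T - 1`.
    refine ⟨((T - 1) ^ m) (w : V), hmin m (by omega), ?_, ?_⟩
    · cases m with
      | zero => simpa using hw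
      | succ m =>
        rw [pow_succ', Module.End.mul_apply, LinearMap.sub_apply, map_sub, hφ]
        simp
    · rw [pow_succ', Module.End.mul_apply, LinearMap.sub_apply, sub_eq_zero] at hk
      simpa using hk
  · have hev : T.HasEigenvalue μ := by
      rw [Module.End.hasEigenvalue_iff_isRoot_charpoly]
      exact isRoot_of_mem_roots (Multiset.mem_of_mem_erase hμ)
    obtain ⟨z, hz⟩ := hev.exists_hasEigenvector
    refine ⟨z, hz.2, ?_, hz.apply_eq_smul⟩
    have h2 := hφ z
    rw [hz.apply_eq_smul, map_smul, smul_eq_mul] at h2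
    have : (μ - 1) * φ z = 0 := by rw [sub_mul, h2]; ring
    exact (mul_eq_zero.1 this).resolve_left (sub_ne_zero.2 h1)

/-! ### Cheeger's inequality for a flow with equal row and column sums -/

/-- The level sets of a nonnegative function carry enough flow: a layer-cake argument. -/
theorem expansion_mul_sum_le_sum_pos_part {ι : Type*} [Fintype ι] [DecidableEq ι]
    {F : ι → ι → ℝ} {w : ι → ℝ} {c : ℝ} (U : Finset ι)
    (hc : ∀ S ⊆ U, S.Nonempty → c * ∑ i ∈ S, w i ≤ ∑ i ∈ S, ∑ j ∈ Sᶜ, F i j)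
    (h : ι → ℝ) (h0 : ∀ i, 0 ≤ h i) (hU : ∀ i, h i ≠ 0 → i ∈ U) :
    c * ∑ i, w i * h i ≤ ∑ i, ∑ j, F i j * max (h i - h j) 0 := by
  -- Induction on the size of the support: subtracting the least nonzero value `m` on the support
  -- peels off one layer, which contributes `m` times the cut of the support.
  induction hN : (Finset.univ.filter fun i => h i ≠ 0).card using Nat.strong_induction_on
    generalizing h with
  | _ N ih =>
  set S := Finset.univ.filter fun i => h i ≠ 0 with hS
  by_cases hne : S.Nonempty
  · obtain ⟨i₀, hi₀, hmin⟩ := Finset.exists_min_image S h hne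
    set m := h i₀ with hm
    have hm0 : 0 < m := lt_of_le_of_ne (h0 i₀) (Ne.symm (Finset.mem_filter.1 hi₀).2)
    have hout : ∀ i, i ∉ S → h i = 0 := by
      intro i hi
      by_contra hne
      exact hi (by simp [hS, hne])
    set h' : ι → ℝ := fun i => if i ∈ S then h i - m else 0 with hh'
    have h'0 : ∀ i, 0 ≤ h' i := by
      intro i
      by_cases hi : i ∈ S
      · simpa [hh', hi] using hmin i hi
      · simp [hh', hi]
    have h'S : ∀ i, h' i ≠ 0 → i ∈ S := by
      intro i hi
      by_contra hiS
      simp [hh', hiS] at hi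
    have hlt : (Finset.univ.filter fun i => h' i ≠ 0).card < N := by
      rw [← hN]
      apply Finset.card_lt_card
      refine ⟨fun i hi => h'S i (Finset.mem_filter.1 hi).2, fun hsub => ?_⟩
      have := (Finset.mem_filter.1 (hsub hi₀)).2
      simp [hh', hm] at this
    have hSU : S ⊆ U := fun i hi => hU i (Finset.mem_filter.1 hi).2
    have key := ih _ hlt h' h'0 (fun i hi => hSU (h'S i hi)) rfl
    have hcut := hc S hSU hne
    have hL : ∑ i, w i * h i = m * ∑ i ∈ S, w i + ∑ i, w i * h' i := by
      rw [Finset.mul_sum, ← Finset.sum_filter_add_sum_filter_not Finset.univ (· ∈ S),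
        ← Finset.sum_filter_add_sum_filter_not (s := Finset.univ) (p := (· ∈ S))
          (f := fun i => w i * h' i)]
      rw [Finset.filter_mem_eq_inter, Finset.univ_inter]
      have e1 : ∑ i ∈ Finset.univ.filter (· ∉ S), w i * h i = 0 :=
        Finset.sum_eq_zero fun i hi => by rw [hout i (Finset.mem_filter.1 hi).2, mul_zero]
      have e2 : ∑ i ∈ Finset.univ.filter (· ∉ S), w i * h' i = 0 :=
        Finset.sum_eq_zero fun i hi => by
          simp only [hh', if_neg (Finset.mem_filter.1 hi).2, mul_zero]
      rw [e1, e2, add_zero, add_zero, ← Finset.sum_add_distrib]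
      refine Finset.sum_congr rfl fun i hi => ?_
      simp only [hh', if_pos hi]
      ring
    have hRR : ∑ i, ∑ j, F i j * max (h i - h j) 0 =
        m * ∑ i ∈ S, ∑ j ∈ Sᶜ, F i j + ∑ i, ∑ j, F i j * max (h' i - h' j) 0 := by
      have e : ∑ i ∈ S, ∑ j ∈ Sᶜ, F i j =
          ∑ i, ∑ j, if i ∈ S then (if j ∈ S then 0 else F i j) else 0 := by
        rw [← Finset.sum_subset (Finset.subset_univ S)]
        · refine Finset.sum_congr rfl fun i hi => ?_
          rw [← Finset.sum_subset (Finset.subset_univ Sᶜ)]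
          · refine Finset.sum_congr rfl fun j hj => ?_
            simp [hi, Finset.mem_compl.1 hj]
          · intro j _ hj
            simp [hi, Finset.mem_compl.not.1 hj |> not_not.1]
        · intro i _ hi
          simp [hi]
      rw [e, Finset.mul_sum, ← Finset.sum_add_distrib]
      refine Finset.sum_congr rfl fun i _ => ?_
      rw [Finset.mul_sum, ← Finset.sum_add_distrib]
      refine Finset.sum_congr rfl fun j _ => ?_
      by_cases hi : i ∈ S
      · by_cases hj : j ∈ S
        · simp [hh', hi, hj]
        · have := hmin i hi
          simp only [hh', hi, hj, if_true, if_false, hout j hj, sub_zero]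
          rw [max_eq_left (h0 i), max_eq_left (by linarith)]
          ring
      · have h1 : max (h i - h j) 0 = 0 := by
          rw [hout i hi]
          exact max_eq_right (by linarith [h0 j])
        have h2 : max (h' i - h' j) 0 = 0 := by
          have : h' i = 0 := by simp [hh', hi]
          rw [this]
          exact max_eq_right (by linarith [h'0 j])
        rw [h1, h2]
        simp [hi]
    rw [hL, hRR]
    nlinarith [mul_le_mul_of_nonneg_left hcut hm0.le]
  · have hz : ∀ i, h i = 0 := by
      intro i
      by_contra hi
      exact hne ⟨i, by simp [hS, hi]⟩
    simp [hz]

/-- Cheeger's inequality for a nonnegative function supported where all cuts expand. -/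
theorem sq_expansion_mul_sum_sq_le {ι : Type*} [Fintype ι] [DecidableEq ι]
    {F : ι → ι → ℝ} {w : ι → ℝ} {c : ℝ} (hF : ∀ i j, 0 ≤ F i j) (hw : ∀ i, 0 ≤ w i)
    (hrow : ∀ i, ∑ j, F i j = w i) (hcol : ∀ j, ∑ i, F i j = w j) (hc0 : 0 ≤ c) (U : Finset ι)
    (hc : ∀ S ⊆ U, S.Nonempty → c * ∑ i ∈ S, w i ≤ ∑ i ∈ S, ∑ j ∈ Sᶜ, F i j)
    (h : ι → ℝ) (h0 : ∀ i, 0 ≤ h i) (hU : ∀ i, h i ≠ 0 → i ∈ U) :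
    c ^ 2 * ∑ i, w i * h i ^ 2 ≤ ∑ i, ∑ j, F i j * (h i - h j) ^ 2 := by
  have hrow' : ∀ a : ι → ℝ, ∑ i, ∑ j, F i j * a i = ∑ i, w i * a i := fun a =>
    Finset.sum_congr rfl fun i _ => by rw [← Finset.sum_mul, hrow]
  have hcol' : ∀ a : ι → ℝ, ∑ i, ∑ j, F i j * a j = ∑ i, w i * a i := fun a => by
    rw [Finset.sum_comm]
    exact Finset.sum_congr rfl fun i _ => by rw [← Finset.sum_mul, hcol]
  set N := ∑ i, w i * h i ^ 2 with hN
  set E := ∑ i, ∑ j, F i j * (h i - h j) ^ 2 with hE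
  have hN0 : 0 ≤ N := Finset.sum_nonneg fun i _ => mul_nonneg (hw i) (sq_nonneg _)
  have hE0 : 0 ≤ E := Finset.sum_nonneg fun i _ => Finset.sum_nonneg fun j _ =>
    mul_nonneg (hF i j) (sq_nonneg _)
  have h1 := expansion_mul_sum_le_sum_pos_part U hc (fun i => h i ^ 2) (fun i => sq_nonneg _)
    (fun i hi => hU i (by simpa using hi))
  have h2 : ∑ i, ∑ j, F i j * max (h i ^ 2 - h j ^ 2) 0 =
      (∑ i, ∑ j, F i j * (|h i - h j| * (h i + h j))) / 2 := by
    -- Positive part as half of absolute value plus signed value; the signed part sums to zero since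
    -- row and column sums agree.
    have e1 : ∀ i j, F i j * max (h i ^ 2 - h j ^ 2) 0 =
        (F i j * (|h i - h j| * (h i + h j)) + (F i j * h i ^ 2 - F i j * h j ^ 2)) / 2 := by
      intro i j
      rcases le_total (h j) (h i) with hij | hij
      · rw [max_eq_left (by nlinarith [h0 i, h0 j]), abs_of_nonneg (by linarith)]
        ring
      · rw [max_eq_right (by nlinarith [h0 i, h0 j]), abs_of_nonpos (by linarith)]
        ring
    simp_rw [e1, ← Finset.sum_div, Finset.sum_add_distrib, Finset.sum_sub_distrib]
    rw [hrow' (fun i => h i ^ 2), hcol' (fun i => h i ^ 2)]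
    ring
  have h3 : (∑ i, ∑ j, F i j * (|h i - h j| * (h i + h j))) ^ 2 ≤ E * (4 * N) := by
    have hsum : ∑ i, ∑ j, F i j * (h i + h j) ^ 2 ≤ 4 * N := by
      calc ∑ i, ∑ j, F i j * (h i + h j) ^ 2
          ≤ ∑ i, ∑ j, (2 * (F i j * h i ^ 2) + 2 * (F i j * h j ^ 2)) := by
            refine Finset.sum_le_sum fun i _ => Finset.sum_le_sum fun j _ => ?_
            nlinarith [mul_nonneg (hF i j) (sq_nonneg (h i - h j))]
        _ = 4 * N := by
            simp_rw [Finset.sum_add_distrib, ← Finset.mul_sum]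
            rw [hrow' (fun i => h i ^ 2), hcol' (fun i => h i ^ 2)]
            ring
    refine le_trans ?_ (mul_le_mul_of_nonneg_left hsum hE0)
    rw [hE]
    simp_rw [← Fintype.sum_prod_type']
    refine Finset.sum_sq_le_sum_mul_sum_of_sq_le_mul _
      (fun x _ => mul_nonneg (hF _ _) (sq_nonneg _))
      (fun x _ => mul_nonneg (hF _ _) (sq_nonneg _)) fun x _ => ?_
    rw [mul_pow, mul_pow, sq_abs]
    apply le_of_eq
    ring
  rw [h2] at h1
  have h4 : (c * N) ^ 2 ≤ E * N := by
    have h5 : (c * N) ^ 2 ≤ ((∑ i, ∑ j, F i j * (|h i - h j| * (h i + h j))) / 2) ^ 2 :=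
      pow_le_pow_left₀ (mul_nonneg hc0 hN0) h1 2
    nlinarith
  rcases hN0.eq_or_lt with hN1 | hN1
  · rw [← hN1]; simpa using hE0
  · have : (c ^ 2 * N) * N ≤ E * N := by nlinarith
    exact le_of_mul_le_mul_right this hN1

theorem exists_weighted_median {ι : Type*} [Fintype ι] [Nonempty ι] {w : ι → ℝ}
    (hw : ∀ i, 0 ≤ w i) (h1 : ∑ i, w i = 1) (f : ι → ℝ) :
    ∃ c, ∑ i with c < f i, w i ≤ 1 / 2 ∧ ∑ i with f i < c, w i ≤ 1 / 2 := by
  obtain ⟨im, -, him⟩ := Finset.exists_max_image Finset.univ f Finset.univ_nonempty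
  -- The median is the smallest value of `f` whose strict superlevel set has mass at most `1/2`; the
  -- next lower value fails this test, which bounds the mass below the median.
  have hne : (Finset.univ.filter fun i => ∑ k with f i < f k, w k ≤ 1 / 2).Nonempty := by
    refine ⟨im, Finset.mem_filter.2 ⟨Finset.mem_univ _, ?_⟩⟩
    rw [Finset.filter_false_of_mem fun i _ => not_lt.2 (him i (Finset.mem_univ _))]
    norm_num
  obtain ⟨i₀, hi₀, hmin⟩ := Finset.exists_min_image _ f hne
  refine ⟨f i₀, (Finset.mem_filter.1 hi₀).2, ?_⟩
  by_cases hlow : (Finset.univ.filter fun i => f i < f i₀).Nonempty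
  · obtain ⟨j, hj, hjmax⟩ := Finset.exists_max_image _ f hlow
    have hj' : 1 / 2 < ∑ k with f j < f k, w k := by
      by_contra hcon
      have := hmin j (Finset.mem_filter.2 ⟨Finset.mem_univ _, not_lt.1 hcon⟩)
      exact absurd (Finset.mem_filter.1 hj).2 (not_lt.2 this)
    have hsplit := Finset.sum_filter_add_sum_filter_not Finset.univ (fun k => f j < f k) w
    have hle : ∑ i with f i < f i₀, w i ≤ ∑ i with ¬ f j < f i, w i :=
      Finset.sum_le_sum_of_subset_of_nonneg
        (fun i hi => Finset.mem_filter.2 ⟨Finset.mem_univ _, not_lt.2 (hjmax i hi)⟩)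
        fun i _ _ => hw i
    linarith
  · rw [Finset.not_nonempty_iff_eq_empty.1 hlow]
    norm_num

/-- Cheeger's inequality for a function of mean zero. -/
theorem sq_expansion_mul_variance_le {ι : Type*} [Fintype ι] [DecidableEq ι] [Nonempty ι]
    {F : ι → ι → ℝ} {w : ι → ℝ} {c : ℝ} (hF : ∀ i j, 0 ≤ F i j) (hw : ∀ i, 0 ≤ w i)
    (hrow : ∀ i, ∑ j, F i j = w i) (hcol : ∀ j, ∑ i, F i j = w j) (h1 : ∑ i, w i = 1)
    (hc0 : 0 ≤ c)
    (hc : ∀ S : Finset ι, S.Nonempty → ∑ i ∈ S, w i ≤ 1 / 2 →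
      c * ∑ i ∈ S, w i ≤ ∑ i ∈ S, ∑ j ∈ Sᶜ, F i j)
    (f : ι → ℝ) (hf : ∑ i, w i * f i = 0) :
    c ^ 2 * ∑ i, w i * f i ^ 2 ≤ ∑ i, ∑ j, F i j * (f i - f j) ^ 2 := by
  obtain ⟨t, ht1, ht2⟩ := exists_weighted_median hw h1 f
  have small : ∀ U : Finset ι, ∑ i ∈ U, w i ≤ 1 / 2 → ∀ S ⊆ U, S.Nonempty →
      c * ∑ i ∈ S, w i ≤ ∑ i ∈ S, ∑ j ∈ Sᶜ, F i j := fun U hU S hS hne =>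
    hc S hne ((Finset.sum_le_sum_of_subset_of_nonneg hS fun i _ _ => hw i).trans hU)
  have hp := sq_expansion_mul_sum_sq_le hF hw hrow hcol hc0 _ (small _ ht1)
    (fun i => max (f i - t) 0) (fun i => le_max_right _ _) (fun i hi => by
      refine Finset.mem_filter.2 ⟨Finset.mem_univ _, ?_⟩
      by_contra hcon
      exact hi (max_eq_right (by linarith)))
  have hm := sq_expansion_mul_sum_sq_le hF hw hrow hcol hc0 _ (small _ ht2)
    (fun i => max (t - f i) 0) (fun i => le_max_right _ _) (fun i hi => by
      refine Finset.mem_filter.2 ⟨Finset.mem_univ _, ?_⟩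
      by_contra hcon
      exact hi (max_eq_right (by linarith)))
  -- Since `f` has mean zero, recentring at the median `t` can only increase the second moment. The
  -- two parts of `f - t` are supported on sets of mass at most `1/2`, where cuts expand.
  have hN : ∑ i, w i * f i ^ 2 ≤
      ∑ i, w i * max (f i - t) 0 ^ 2 + ∑ i, w i * max (t - f i) 0 ^ 2 := by
    have e : ∑ i, w i * max (f i - t) 0 ^ 2 + ∑ i, w i * max (t - f i) 0 ^ 2 =
        ∑ i, w i * f i ^ 2 - 2 * t * ∑ i, w i * f i + t ^ 2 * ∑ i, w i := by
      rw [← Finset.sum_add_distrib, Finset.mul_sum, Finset.mul_sum, ← Finset.sum_sub_distrib,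
        ← Finset.sum_add_distrib]
      refine Finset.sum_congr rfl fun i _ => ?_
      rcases le_total (f i) t with h | h
      · rw [max_eq_right (by linarith), max_eq_left (by linarith)]; ring
      · rw [max_eq_left (by linarith), max_eq_right (by linarith)]; ring
    rw [e, hf, h1]
    nlinarith [sq_nonneg t]
  have hE : ∑ i, ∑ j, F i j * (max (f i - t) 0 - max (f j - t) 0) ^ 2 +
      ∑ i, ∑ j, F i j * (max (t - f i) 0 - max (t - f j) 0) ^ 2 ≤
      ∑ i, ∑ j, F i j * (f i - f j) ^ 2 := by
    simp_rw [← Finset.sum_add_distrib]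
    refine Finset.sum_le_sum fun i _ => Finset.sum_le_sum fun j _ => ?_
    rw [← mul_add]
    refine mul_le_mul_of_nonneg_left ?_ (hF i j)
    rcases le_total (f i) t with h | h <;> rcases le_total (f j) t with h' | h'
    · rw [max_eq_right (a := f i - t) (by linarith), max_eq_right (a := f j - t) (by linarith),
        max_eq_left (by linarith), max_eq_left (by linarith)]
      nlinarith
    · rw [max_eq_right (a := f i - t) (by linarith), max_eq_left (a := f j - t) (by linarith),
        max_eq_left (by linarith), max_eq_right (by linarith)]
      nlinarith [mul_nonneg (sub_nonneg.2 h) (sub_nonneg.2 h')]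
    · rw [max_eq_left (a := f i - t) (by linarith), max_eq_right (a := f j - t) (by linarith),
        max_eq_right (by linarith), max_eq_left (by linarith)]
      nlinarith [mul_nonneg (sub_nonneg.2 h) (sub_nonneg.2 h')]
    · rw [max_eq_left (a := f i - t) (by linarith), max_eq_left (a := f j - t) (by linarith),
        max_eq_right (by linarith), max_eq_right (by linarith)]
      nlinarith
  have := mul_le_mul_of_nonneg_left hN (sq_nonneg c)
  rw [mul_add] at this
  linarith

/-! ### The upper bound for stochastic matrices -/

/-- The complexification of a real matrix, as an endomorphism. -/
noncomputable def complexEnd {n : ℕ} (R : Matrix (Fin n) (Fin n) ℝ) :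
    Module.End ℂ (Fin n → ℂ) :=
  Matrix.toLin' (R.map (algebraMap ℝ ℂ))

theorem complexEnd_apply {n : ℕ} (R : Matrix (Fin n) (Fin n) ℝ) (x : Fin n → ℂ) (i : Fin n) :
    complexEnd R x i = ∑ j, (R i j : ℂ) * x j := by
  simp [complexEnd, Matrix.mulVec, dotProduct]

theorem eigenvalues_eq_roots_charpoly_complexEnd {n : ℕ} (R : Matrix (Fin n) (Fin n) ℝ) :
    eigenvalues R = (complexEnd R).charpoly.roots := by
  rw [complexEnd, Matrix.charpoly_toLin', eigenvalues]

theorem card_eigenvalues {n : ℕ} (R : Matrix (Fin n) (Fin n) ℝ) : (eigenvalues R).card = n := by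
  rw [eigenvalues, ← (IsAlgClosed.splits _).natDegree_eq_card_roots,
    Matrix.charpoly_natDegree_eq_dim, Fintype.card_fin]

/-- The linear functional `x ↦ ∑ i, w i * x i` on complex vectors. -/
noncomputable def weightedSum {n : ℕ} (w : Fin n → ℝ) : (Fin n → ℂ) →ₗ[ℂ] ℂ :=
  ∑ i, (w i : ℂ) • LinearMap.proj i

theorem weightedSum_apply {n : ℕ} (w : Fin n → ℝ) (x : Fin n → ℂ) :
    weightedSum w x = ∑ i, (w i : ℂ) * x i := by
  simp [weightedSum]

theorem weightedSum_complexEnd {n : ℕ} {R : Matrix (Fin n) (Fin n) ℝ} {w : Fin n → ℝ}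
    (hw : ∀ j, ∑ i, w i * R i j = w j) (x : Fin n → ℂ) :
    weightedSum w (complexEnd R x) = weightedSum w x := by
  simp_rw [weightedSum_apply, complexEnd_apply, Finset.mul_sum]
  rw [Finset.sum_comm]
  refine Finset.sum_congr rfl fun j _ => ?_
  rw [← hw j, Complex.ofReal_sum, Finset.sum_mul]
  exact Finset.sum_congr rfl fun i _ => by push_cast; ring

/-- The upper bound on expansion for a stochastic matrix with stationary distribution `w`. -/
theorem sq_expansion_le_of_stochastic {n : ℕ} {P : Matrix (Fin n) (Fin n) ℝ} {w : Fin n → ℝ}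
    {c : ℝ} (hP : ∀ i j, 0 ≤ P i j) (hrow : ∀ i, ∑ j, P i j = 1) (hw : ∀ i, 0 < w i)
    (hstat : ∀ j, ∑ i, w i * P i j = w j) (h1 : ∑ i, w i = 1) (hc0 : 0 ≤ c)
    (hc : ∀ S : Finset (Fin n), S.Nonempty → ∑ i ∈ S, w i ≤ 1 / 2 →
      c * ∑ i ∈ S, w i ≤ ∑ i ∈ S, ∑ j ∈ Sᶜ, w i * P i j)
    {μ : ℂ} (hμ : μ ∈ (eigenvalues P).erase 1) : c ^ 2 ≤ 2 * (1 - μ.re) := by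
  rw [eigenvalues_eq_roots_charpoly_complexEnd] at hμ
  obtain ⟨z, hz0, hz1, hz⟩ := exists_eigenvector_mem_ker (complexEnd P) (weightedSum w)
    (weightedSum_complexEnd hstat) hμ
  have hne : Nonempty (Fin n) := by
    by_contra hemp
    rw [not_nonempty_iff] at hemp
    exact hz0 (Subsingleton.elim _ _)
  have hrow' : ∀ i, ∑ j, w i * P i j = w i := fun i => by rw [← Finset.mul_sum, hrow, mul_one]
  have hre : ∑ i, w i * (z i).re = 0 := by
    have := congrArg Complex.re hz1
    simpa [weightedSum_apply] using this
  have him : ∑ i, w i * (z i).im = 0 := by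
    have := congrArg Complex.im hz1
    simpa [weightedSum_apply] using this
  have ha := sq_expansion_mul_variance_le (F := fun i j => w i * P i j)
    (fun i j => mul_nonneg (hw i).le (hP i j)) (fun i => (hw i).le) hrow' hstat h1 hc0 hc
    (fun i => (z i).re) hre
  have hb := sq_expansion_mul_variance_le (F := fun i j => w i * P i j)
    (fun i j => mul_nonneg (hw i).le (hP i j)) (fun i => (hw i).le) hrow' hstat h1 hc0 hc
    (fun i => (z i).im) him
  have hPre : ∀ i, ∑ j, P i j * (z j).re = μ.re * (z i).re - μ.im * (z i).im := fun i => by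
    have := congrArg Complex.re (congrFun hz i)
    simpa [complexEnd_apply] using this
  have hPim : ∀ i, ∑ j, P i j * (z j).im = μ.re * (z i).im + μ.im * (z i).re := fun i => by
    have := congrArg Complex.im (congrFun hz i)
    simpa [complexEnd_apply] using this
  have energy : ∀ a : Fin n → ℝ, ∑ i, ∑ j, w i * P i j * (a i - a j) ^ 2 =
      2 * ∑ i, w i * a i ^ 2 - 2 * ∑ i, w i * a i * ∑ j, P i j * a j := by
    intro a
    have e1 : ∑ i, ∑ j, w i * P i j * a i ^ 2 = ∑ i, w i * a i ^ 2 :=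
      Finset.sum_congr rfl fun i _ => by rw [← Finset.sum_mul, hrow']
    have e2 : ∑ i, ∑ j, w i * P i j * a j ^ 2 = ∑ i, w i * a i ^ 2 := by
      rw [Finset.sum_comm]
      exact Finset.sum_congr rfl fun i _ => by rw [← Finset.sum_mul, hstat]
    have e3 : ∑ i, ∑ j, w i * P i j * (a i - a j) ^ 2 =
        ∑ i, ∑ j, w i * P i j * a i ^ 2 + ∑ i, ∑ j, w i * P i j * a j ^ 2 -
          2 * ∑ i, w i * a i * ∑ j, P i j * a j := by
      simp_rw [Finset.mul_sum, ← Finset.sum_add_distrib, ← Finset.sum_sub_distrib]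
      exact Finset.sum_congr rfl fun i _ => Finset.sum_congr rfl fun j _ => by ring
    rw [e3, e1, e2]
    ring
  rw [energy] at ha hb
  simp_rw [hPre] at ha
  simp_rw [hPim] at hb
  -- The terms with `μ.im` cancel between real and imaginary parts, so only `μ.re` survives.
  have hcross : ∑ i, w i * (z i).re * (μ.re * (z i).re - μ.im * (z i).im) +
      ∑ i, w i * (z i).im * (μ.re * (z i).im + μ.im * (z i).re) =
      μ.re * (∑ i, w i * (z i).re ^ 2 + ∑ i, w i * (z i).im ^ 2) := by
    rw [← Finset.sum_add_distrib, ← Finset.sum_add_distrib, Finset.mul_sum]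
    exact Finset.sum_congr rfl fun i _ => by ring
  have hpos : 0 < ∑ i, w i * (z i).re ^ 2 + ∑ i, w i * (z i).im ^ 2 := by
    rw [← Finset.sum_add_distrib]
    obtain ⟨i, hi⟩ := Function.ne_iff.1 hz0
    refine Finset.sum_pos' (fun i _ => ?_) ⟨i, Finset.mem_univ _, ?_⟩
    · nlinarith [mul_nonneg (hw i).le (sq_nonneg (z i).re),
        mul_nonneg (hw i).le (sq_nonneg (z i).im)]
    · rw [← mul_add]
      refine mul_pos (hw i) ?_
      have := Complex.normSq_pos.2 hi
      rw [Complex.normSq_apply] at this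
      nlinarith
  refine le_of_mul_le_mul_right ?_ hpos
  nlinarith

/-! ### The lazy walk and the lower bound for stochastic matrices -/

/-- The weighted `ℓ²` seminorm. -/
noncomputable def weightedSeminorm {n : ℕ} (w : Fin n → ℝ) : Seminorm ℂ (Fin n → ℂ) :=
  (normSeminorm ℂ (EuclideanSpace ℂ (Fin n))).comp
    ((WithLp.linearEquiv 2 ℂ (Fin n → ℂ)).symm.toLinearMap ∘ₗ
      LinearMap.pi fun i => ((Real.sqrt (w i) : ℝ) : ℂ) • LinearMap.proj i)

theorem weightedSeminorm_sq {n : ℕ} {w : Fin n → ℝ} (hw : ∀ i, 0 ≤ w i) (x : Fin n → ℂ) :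
    weightedSeminorm w x ^ 2 = ∑ i, w i * ‖x i‖ ^ 2 := by
  simp only [weightedSeminorm, Seminorm.comp_apply, coe_normSeminorm, EuclideanSpace.norm_sq_eq]
  refine Finset.sum_congr rfl fun i _ => ?_
  simp [mul_pow, Real.sq_sqrt (hw i)]

/-- Jensen's inequality in each row, then averaging over the stationary distribution. -/
theorem weightedSeminorm_complexEnd_le {n : ℕ} {P : Matrix (Fin n) (Fin n) ℝ} {w : Fin n → ℝ}
    (hP : ∀ i j, 0 ≤ P i j) (hrow : ∀ i, ∑ j, P i j = 1) (hw : ∀ i, 0 ≤ w i)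
    (hstat : ∀ j, ∑ i, w i * P i j = w j) (x : Fin n → ℂ) :
    weightedSeminorm w (complexEnd P x) ≤ weightedSeminorm w x := by
  refine le_of_sq_le_sq ?_ (apply_nonneg _ _)
  rw [weightedSeminorm_sq hw, weightedSeminorm_sq hw]
  have jensen : ∀ i, ‖complexEnd P x i‖ ^ 2 ≤ ∑ j, P i j * ‖x j‖ ^ 2 := by
    intro i
    have h1 : ‖complexEnd P x i‖ ≤ ∑ j, P i j * ‖x j‖ := by
      rw [complexEnd_apply]
      refine (norm_sum_le _ _).trans (Finset.sum_le_sum fun j _ => ?_)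
      rw [norm_mul, Complex.norm_real, Real.norm_of_nonneg (hP i j)]
    have h2 : (∑ j, P i j * ‖x j‖) ^ 2 ≤ (∑ j, P i j) * ∑ j, P i j * ‖x j‖ ^ 2 :=
      Finset.sum_sq_le_sum_mul_sum_of_sq_le_mul _ (fun j _ => hP i j)
        (fun j _ => mul_nonneg (hP i j) (sq_nonneg _)) fun j _ => by
          apply le_of_eq
          ring
    rw [hrow, one_mul] at h2
    exact (pow_le_pow_left₀ (norm_nonneg _) h1 2).trans h2
  calc ∑ i, w i * ‖complexEnd P x i‖ ^ 2 ≤ ∑ i, w i * ∑ j, P i j * ‖x j‖ ^ 2 :=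
        Finset.sum_le_sum fun i _ => mul_le_mul_of_nonneg_left (jensen i) (hw i)
    _ = ∑ j, w j * ‖x j‖ ^ 2 := by
        simp_rw [Finset.mul_sum]
        rw [Finset.sum_comm]
        refine Finset.sum_congr rfl fun j _ => ?_
        rw [← hstat j, Finset.sum_mul]
        exact Finset.sum_congr rfl fun i _ => by ring

/-- The lazy version `(1 + X) / 2` of an operator, as a polynomial. -/
noncomputable def lazyPoly : ℂ[X] := C (1 / 2) * (1 + X)

theorem aeval_lazyPoly_apply {V : Type*} [AddCommGroup V] [Module ℂ V] (T : Module.End ℂ V)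
    (x : V) : aeval T lazyPoly x = (1 / 2 : ℂ) • (x + T x) := by
  simp [lazyPoly, Module.algebraMap_end_apply]

/-- Expanding `‖1 + μ‖ ^ 2 / 4` with `‖μ‖ ≤ 1` gives at most `(1 + μ.re) / 2`. Laziness thus turns a
gap in real part into a gap in modulus. -/
theorem norm_eval_lazyPoly_sq_le {μ : ℂ} (h : ‖μ‖ ≤ 1) :
    ‖lazyPoly.eval μ‖ ^ 2 ≤ 1 - (1 - μ.re) / 2 := by
  have h1 : ‖μ‖ ^ 2 ≤ 1 := pow_le_one₀ (norm_nonneg _) h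
  rw [← Complex.normSq_eq_norm_sq, Complex.normSq_apply] at h1 ⊢
  simp [lazyPoly]
  nlinarith

/-- The lazy version of a real matrix, acting on real vectors. -/
noncomputable def lazyStep {n : ℕ} (P : Matrix (Fin n) (Fin n) ℝ) (f : Fin n → ℝ) : Fin n → ℝ :=
  fun i => (f i + ∑ j, P i j * f j) / 2

theorem aeval_lazyPoly_pow_apply_ofReal {n : ℕ} (P : Matrix (Fin n) (Fin n) ℝ) (f : Fin n → ℝ)
    (k : ℕ) : (aeval (complexEnd P) lazyPoly ^ k) (fun i => (f i : ℂ)) =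
      fun i => (((lazyStep P)^[k] f i : ℝ) : ℂ) := by
  induction k with
  | zero => simp
  | succ k ih =>
    rw [pow_succ', Module.End.mul_apply, ih, Function.iterate_succ', Function.comp_apply,
      aeval_lazyPoly_apply]
    ext i
    simp only [Pi.smul_apply, Pi.add_apply, complexEnd_apply, lazyStep, smul_eq_mul]
    push_cast
    ring

theorem lazyStep_nonneg {n : ℕ} {P : Matrix (Fin n) (Fin n) ℝ} (hP : ∀ i j, 0 ≤ P i j)
    {f : Fin n → ℝ} (hf : ∀ i, 0 ≤ f i) (k : ℕ) (i : Fin n) : 0 ≤ (lazyStep P)^[k] f i := by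
  induction k generalizing i with
  | zero => exact hf i
  | succ k ih =>
    rw [Function.iterate_succ', Function.comp_apply]
    have := Finset.sum_nonneg fun j (_ : j ∈ Finset.univ) => mul_nonneg (hP i j) (ih j)
    exact div_nonneg (add_nonneg (ih i) this) two_pos.le

theorem lazyStep_affine {n : ℕ} {P : Matrix (Fin n) (Fin n) ℝ} (hrow : ∀ i, ∑ j, P i j = 1)
    (f : Fin n → ℝ) (s : ℝ) (k : ℕ) :
    (lazyStep P)^[k] (fun i => f i - s) = fun i => (lazyStep P)^[k] f i - s := by
  induction k with
  | zero => rfl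
  | succ k ih =>
    rw [Function.iterate_succ', Function.comp_apply, Function.comp_apply, ih]
    ext i
    simp only [lazyStep, mul_sub, Finset.sum_sub_distrib, ← Finset.sum_mul, hrow]
    ring

theorem lazyStep_le_one {n : ℕ} {P : Matrix (Fin n) (Fin n) ℝ} (hP : ∀ i j, 0 ≤ P i j)
    (hrow : ∀ i, ∑ j, P i j = 1) {f : Fin n → ℝ} (hf : ∀ i, f i ≤ 1) (k : ℕ) (i : Fin n) :
    (lazyStep P)^[k] f i ≤ 1 := by
  induction k generalizing i with
  | zero => exact hf i
  | succ k ih =>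
    rw [Function.iterate_succ', Function.comp_apply]
    have : ∑ j, P i j * (lazyStep P)^[k] f j ≤ 1 := by
      rw [← hrow i]
      exact Finset.sum_le_sum fun j _ => mul_le_of_le_one_right (hP i j) (ih j)
    have := ih i
    simp only [lazyStep]
    linarith

/-- The flow into a set equals the flow out of it. -/
theorem sum_compl_comm_of_stationary {ι : Type*} [Fintype ι] [DecidableEq ι] {F : ι → ι → ℝ}
    {w : ι → ℝ} (hrow : ∀ i, ∑ j, F i j = w i) (hcol : ∀ j, ∑ i, F i j = w j) (S : Finset ι) :
    ∑ i ∈ Sᶜ, ∑ j ∈ S, F i j = ∑ i ∈ S, ∑ j ∈ Sᶜ, F i j := by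
  have h1 : ∑ i ∈ S, ∑ j ∈ S, F i j + ∑ i ∈ S, ∑ j ∈ Sᶜ, F i j = ∑ i ∈ S, w i := by
    rw [← Finset.sum_add_distrib]
    exact Finset.sum_congr rfl fun i _ => by rw [Finset.sum_add_sum_compl, hrow]
  have h2 : ∑ i ∈ S, ∑ j ∈ S, F i j + ∑ i ∈ Sᶜ, ∑ j ∈ S, F i j = ∑ i ∈ S, w i := by
    rw [Finset.sum_add_sum_compl, Finset.sum_comm]
    exact Finset.sum_congr rfl fun i _ => hcol i
  linarith

/-- The mass remaining in `S` decreases in each lazy step by at most half the flow out of `S`. -/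
theorem le_sum_lazyStep_indicator {n : ℕ} {P : Matrix (Fin n) (Fin n) ℝ} {w : Fin n → ℝ}
    (hP : ∀ i j, 0 ≤ P i j) (hrow : ∀ i, ∑ j, P i j = 1) (hw : ∀ i, 0 ≤ w i)
    (hstat : ∀ j, ∑ i, w i * P i j = w j) (S : Finset (Fin n)) (k : ℕ) :
    ∑ i ∈ S, w i - k / 2 * ∑ i ∈ S, ∑ j ∈ Sᶜ, w i * P i j ≤
      ∑ i ∈ S, w i * (lazyStep P)^[k] (fun i => if i ∈ S then 1 else 0) i := by
  set e : Fin n → ℝ := fun i => if i ∈ S then 1 else 0 with he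
  have he0 : ∀ i, 0 ≤ e i := fun i => by simp only [he]; split_ifs <;> norm_num
  have he1 : ∀ i, e i ≤ 1 := fun i => by simp only [he]; split_ifs <;> norm_num
  induction k with
  | zero =>
    have : ∑ i ∈ S, w i * e i = ∑ i ∈ S, w i :=
      Finset.sum_congr rfl fun i hi => by simp [he, hi]
    simp [this]
  | succ k ih =>
    set f := (lazyStep P)^[k] e with hf
    have hf0 : ∀ i, 0 ≤ f i := lazyStep_nonneg hP he0 k
    have hf1 : ∀ i, f i ≤ 1 := lazyStep_le_one hP hrow he1 k
    -- One step of `P` loses only what stationarity attributes to transitions from outside `S` into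
    -- `S`; as `f ≤ 1`, this is at most the inflow, which equals the outflow.
    have h1 : ∑ i ∈ S, w i * f i - ∑ i ∈ S, ∑ j ∈ Sᶜ, w i * P i j ≤
        ∑ i ∈ S, w i * ∑ j, P i j * f j := by
      rw [← sum_compl_comm_of_stationary (F := fun i j => w i * P i j) (w := w)
        (fun i => by rw [← Finset.mul_sum, hrow, mul_one]) hstat S]
      have h2 : ∑ i ∈ S, ∑ j ∈ S, w i * P i j * f j ≤ ∑ i ∈ S, w i * ∑ j, P i j * f j := by
        refine Finset.sum_le_sum fun i _ => ?_
        rw [Finset.mul_sum]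
        simp_rw [← mul_assoc]
        exact Finset.sum_le_sum_of_subset_of_nonneg (Finset.subset_univ S)
          fun j _ _ => mul_nonneg (mul_nonneg (hw i) (hP i j)) (hf0 j)
      have h3 : ∑ j ∈ S, w j * f j =
          ∑ i ∈ S, ∑ j ∈ S, w i * P i j * f j + ∑ i ∈ Sᶜ, ∑ j ∈ S, w i * P i j * f j := by
        rw [Finset.sum_add_sum_compl, Finset.sum_comm]
        exact Finset.sum_congr rfl fun j _ => by rw [← Finset.sum_mul, hstat]
      have h4 : ∑ i ∈ Sᶜ, ∑ j ∈ S, w i * P i j * f j ≤ ∑ i ∈ Sᶜ, ∑ j ∈ S, w i * P i j :=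
        Finset.sum_le_sum fun i _ => Finset.sum_le_sum fun j _ =>
          mul_le_of_le_one_right (mul_nonneg (hw i) (hP i j)) (hf1 j)
      linarith
    have h5 : ∑ i ∈ S, w i * lazyStep P f i =
        (∑ i ∈ S, w i * f i + ∑ i ∈ S, w i * ∑ j, P i j * f j) / 2 := by
      rw [← Finset.sum_add_distrib, Finset.sum_div]
      exact Finset.sum_congr rfl fun i _ => by simp only [lazyStep]; ring
    rw [Function.iterate_succ', Function.comp_apply, ← hf, h5]
    push_cast
    linarith

/-- Mixing of the lazy walk after `O(n / δ)` steps, for spectral gap `δ`. -/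
theorem weightedSeminorm_lazy_pow_le {n : ℕ} {P : Matrix (Fin n) (Fin n) ℝ} {w : Fin n → ℝ}
    {δ : ℝ} (hn : 2 ≤ n) (hP : ∀ i j, 0 ≤ P i j) (hrow : ∀ i, ∑ j, P i j = 1)
    (hw : ∀ i, 0 ≤ w i) (hstat : ∀ j, ∑ i, w i * P i j = w j) (h1 : ∑ i, w i = 1) (hδ : 0 < δ)
    (hone : (1 : ℂ) ∈ eigenvalues P) (hnorm : ∀ μ ∈ eigenvalues P, ‖μ‖ ≤ 1)
    (hgap : ∀ μ ∈ (eigenvalues P).erase 1, μ.re ≤ 1 - δ) {m : ℕ} (hm : 6 / δ ≤ m)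
    {x : Fin n → ℂ} (hx : weightedSum w x = 0) :
    weightedSeminorm w ((aeval (complexEnd P) lazyPoly ^ (m * (3 * n))) x) ≤
      5 / 64 * weightedSeminorm w x := by
  have hannih : aeval (complexEnd P)
      (((eigenvalues P).erase 1).toList.map fun μ => X - C μ).prod x = 0 := by
    rw [eigenvalues_eq_roots_charpoly_complexEnd] at *
    refine aeval_prod_erase_apply_eq_zero (complexEnd P) (weightedSum w)
      (weightedSum_complexEnd hstat) (v := fun _ => 1) ?_ ?_ hone ?_ hx
    · ext i
      rw [complexEnd_apply]
      simp only [mul_one]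
      rw [← Complex.ofReal_sum, hrow, Complex.ofReal_one]
    · simp only [weightedSum_apply, mul_one]
      rw [← Complex.ofReal_sum, h1]
      simp
    · intro hmem
      have := hgap 1 hmem
      simp only [Complex.one_re] at this
      linarith
  have hprod := prod_aeval_sub_apply_eq_zero (complexEnd P) (lazyPoly ^ m) _ x hannih
  have hstep : ∀ y, weightedSeminorm w (aeval (complexEnd P) lazyPoly y) ≤
      weightedSeminorm w y := by
    intro y
    rw [aeval_lazyPoly_apply, map_smul_eq_mul]
    have h2 := map_add_le_add (weightedSeminorm w) y (complexEnd P y)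
    have h3 := weightedSeminorm_complexEnd_le hP hrow hw hstat y
    have h4 : ‖(1 / 2 : ℂ)‖ = 1 / 2 := by norm_num
    rw [h4]
    linarith
  have hcontr : ∀ y, weightedSeminorm w (aeval (complexEnd P) (lazyPoly ^ m) y) ≤
      1 * weightedSeminorm w y := by
    intro y
    rw [map_pow, one_mul]
    clear hm hprod
    induction m with
    | zero => simp
    | succ m ih => rw [pow_succ', Module.End.mul_apply]; exact (hstep _).trans ih
  -- The choice `m ≥ 6 / δ` gives squared modulus at most `exp (-3) ≤ 1/16`.
  have hsmall : ∀ ν ∈ ((eigenvalues P).erase 1).toList.map fun μ => (lazyPoly ^ m).eval μ,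
      ‖ν‖ ≤ 1 / 4 := by
    intro ν hν
    obtain ⟨μ, hμ, rfl⟩ := List.mem_map.1 hν
    rw [Multiset.mem_toList] at hμ
    have h2 := norm_eval_lazyPoly_sq_le (hnorm μ (Multiset.mem_of_mem_erase hμ))
    have h3 := hgap μ hμ
    have h4 : ‖lazyPoly.eval μ‖ ^ 2 ≤ Real.exp (-(δ / 2)) := by
      have := Real.add_one_le_exp (-(δ / 2))
      linarith
    have h5 : (‖lazyPoly.eval μ‖ ^ m) ^ 2 ≤ Real.exp (-3) := by
      calc (‖lazyPoly.eval μ‖ ^ m) ^ 2 = (‖lazyPoly.eval μ‖ ^ 2) ^ m := by ring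
        _ ≤ Real.exp (-(δ / 2)) ^ m := pow_le_pow_left₀ (sq_nonneg _) h4 m
        _ = Real.exp (m * -(δ / 2)) := (Real.exp_nat_mul _ _).symm
        _ ≤ Real.exp (-3) := by
          apply Real.exp_le_exp.2
          rw [div_le_iff₀ hδ] at hm
          linarith
    have h6 : Real.exp (-3) ≤ (1 / 4) ^ 2 := by
      have h7 : (2.7 : ℝ) ≤ Real.exp 1 := by linarith [Real.exp_one_gt_d9]
      have h8 : Real.exp 3 = Real.exp 1 ^ 3 := by rw [← Real.exp_nat_mul]; norm_num
      have h9 : (16 : ℝ) ≤ Real.exp 3 := by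
        rw [h8]
        exact le_trans (by norm_num) (pow_le_pow_left₀ (by norm_num) h7 3)
      rw [Real.exp_neg]
      exact (inv_anti₀ (by norm_num) h9).trans (by norm_num)
    rw [eval_pow, norm_pow]
    exact le_of_sq_le_sq (h5.trans h6) (by norm_num)
  -- `D = 5` makes the recursion condition an equality: `5/4 + 5/4 = 5/2`. With `n - 1` factors the
  -- bound is `5 ^ (n - 1) / 8 ^ n`, largest at `n = 2`, where it is `5/64`.
  have key := seminorm_pow_le_of_prod_eq_zero (weightedSeminorm w)
    (aeval (complexEnd P) (lazyPoly ^ m)) (b := 1 / 4) (r := 1 / 2) (C := 1) (D := 5)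
    (by norm_num) (by norm_num) (by norm_num) hcontr (by norm_num) _ hsmall x hprod (3 * n)
  rw [map_pow, ← pow_mul] at key
  refine key.trans (mul_le_mul_of_nonneg_right ?_ (apply_nonneg _ _))
  rw [List.length_map, Multiset.length_toList, Multiset.card_erase_of_mem hone,
    card_eigenvalues]
  obtain ⟨d, rfl⟩ := Nat.exists_eq_add_of_le hn
  have e1 : (5 : ℝ) ^ ((2 + d).pred) * (1 / 2) ^ (3 * (2 + d)) = 5 / 64 * (5 / 8) ^ d := by
    rw [show (2 + d).pred = d + 1 by simp; omega, pow_mul, pow_add, pow_add, div_pow (5 : ℝ),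
      show (1 / 2 : ℝ) ^ 3 = 1 / 8 by norm_num, div_pow (1 : ℝ) 8 d]
    ring
  rw [e1]
  have := pow_le_one₀ (n := d) (by norm_num : (0 : ℝ) ≤ 5 / 8) (by norm_num)
  linarith

/-- The lower bound on expansion for a stochastic matrix with stationary distribution `w`. -/
theorem spectral_gap_mul_le_expansion {n : ℕ} {P : Matrix (Fin n) (Fin n) ℝ} {w : Fin n → ℝ}
    {δ : ℝ} (hn : 2 ≤ n) (hP : ∀ i j, 0 ≤ P i j) (hrow : ∀ i, ∑ j, P i j = 1)
    (hw : ∀ i, 0 ≤ w i) (hstat : ∀ j, ∑ i, w i * P i j = w j) (h1 : ∑ i, w i = 1) (hδ : 0 < δ)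
    (hδ2 : δ ≤ 2)
    (hone : (1 : ℂ) ∈ eigenvalues P) (hnorm : ∀ μ ∈ eigenvalues P, ‖μ‖ ≤ 1)
    (hgap : ∀ μ ∈ (eigenvalues P).erase 1, μ.re ≤ 1 - δ) (S : Finset (Fin n))
    (hS : ∑ i ∈ S, w i ≤ 1 / 2) :
    1 / 30 * (δ / n) * ∑ i ∈ S, w i ≤ ∑ i ∈ S, ∑ j ∈ Sᶜ, w i * P i j := by
  set s := ∑ i ∈ S, w i with hs
  have hs0 : 0 ≤ s := Finset.sum_nonneg fun i _ => hw i
  set e : Fin n → ℝ := fun i => if i ∈ S then 1 else 0 with he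
  set m := ⌈6 / δ⌉₊ with hm
  set K := m * (3 * n) with hK
  set g : Fin n → ℝ := fun i => e i - s with hg
  set y := (lazyStep P)^[K] g with hy
  have sum_e : ∀ a : Fin n → ℝ, ∑ i, w i * e i * a i = ∑ i ∈ S, w i * a i := by
    intro a
    rw [← Finset.sum_subset (Finset.subset_univ S)]
    · exact Finset.sum_congr rfl fun i hi => by simp [he, hi]
    · intro i _ hi
      simp [he, hi]
  have sum_e1 : ∑ i, w i * e i = s := by simpa using sum_e fun _ => 1
  have hg0 : ∑ i, w i * g i = 0 := by
    simp only [hg, mul_sub, Finset.sum_sub_distrib, ← Finset.sum_mul, h1, sum_e1]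
    ring
  have hg2 : ∑ i, w i * g i ^ 2 = s * (1 - s) := by
    have e1 : ∀ i, w i * g i ^ 2 = w i * e i - 2 * s * (w i * e i) + s ^ 2 * w i := by
      intro i
      by_cases hi : i ∈ S <;> simp [hg, he, hi] <;> ring
    simp_rw [e1, Finset.sum_add_distrib, Finset.sum_sub_distrib, ← Finset.mul_sum, sum_e1, h1]
    ring
  have hgy : ∑ i, w i * g i * y i ≤ 5 / 64 * ∑ i, w i * g i ^ 2 := by
    have hdecay := weightedSeminorm_lazy_pow_le hn hP hrow hw hstat h1 hδ hone hnorm hgap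
      (Nat.le_ceil _) (x := fun i => (g i : ℂ)) (by
        rw [weightedSum_apply]
        exact_mod_cast congrArg Complex.ofReal hg0)
    rw [← hm, ← hK, aeval_lazyPoly_pow_apply_ofReal, ← hy] at hdecay
    have hsq := pow_le_pow_left₀ (apply_nonneg _ _) hdecay 2
    rw [mul_pow, weightedSeminorm_sq hw, weightedSeminorm_sq hw] at hsq
    simp only [Complex.norm_real, Real.norm_eq_abs, sq_abs] at hsq
    have hG : 0 ≤ ∑ i, w i * g i ^ 2 :=
      Finset.sum_nonneg fun i _ => mul_nonneg (hw i) (sq_nonneg _)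
    have hCS : (∑ i, w i * g i * y i) ^ 2 ≤ (∑ i, w i * g i ^ 2) * ∑ i, w i * y i ^ 2 :=
      Finset.sum_sq_le_sum_mul_sum_of_sq_le_mul _ (fun i _ => mul_nonneg (hw i) (sq_nonneg _))
        (fun i _ => mul_nonneg (hw i) (sq_nonneg _)) fun i _ => by
          apply le_of_eq
          ring
    refine le_of_sq_le_sq ?_ (by positivity)
    refine hCS.trans ((mul_le_mul_of_nonneg_left hsq hG).trans (le_of_eq ?_))
    ring
  have hy' : y = fun i => (lazyStep P)^[K] e i - s := lazyStep_affine hrow e s K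
  have hmassy : ∑ i, w i * y i = 0 := by
    have : ∀ k, ∑ i, w i * (lazyStep P)^[k] g i = 0 := by
      intro k
      induction k with
      | zero => exact hg0
      | succ k ih =>
        rw [Function.iterate_succ', Function.comp_apply]
        set f := (lazyStep P)^[k] g
        have e1 : ∑ i, w i * ∑ j, P i j * f j = ∑ i, w i * f i := by
          simp_rw [Finset.mul_sum]
          rw [Finset.sum_comm]
          refine Finset.sum_congr rfl fun j _ => ?_
          simp_rw [← mul_assoc]
          rw [← Finset.sum_mul, hstat]
        have e2 : ∑ i, w i * lazyStep P f i =
            (∑ i, w i * f i + ∑ i, w i * ∑ j, P i j * f j) / 2 := by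
          rw [← Finset.sum_add_distrib, Finset.sum_div]
          exact Finset.sum_congr rfl fun i _ => by simp only [lazyStep]; ring
        rw [e2, e1, ih]
        norm_num
    exact this K
  have hgy' : ∑ i, w i * g i * y i = ∑ i ∈ S, w i * (lazyStep P)^[K] e i - s ^ 2 := by
    have e1 : ∑ i, w i * g i * y i = ∑ i, w i * e i * y i - s * ∑ i, w i * y i := by
      rw [Finset.mul_sum, ← Finset.sum_sub_distrib]
      exact Finset.sum_congr rfl fun i _ => by simp only [hg]; ring
    rw [e1, hmassy, sum_e, hy']
    simp only [mul_sub, Finset.sum_sub_distrib, ← Finset.sum_mul, ← hs]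
    ring
  have hlow := le_sum_lazyStep_indicator hP hrow hw hstat S K
  rw [← he, ← hs] at hlow
  set Φ := ∑ i ∈ S, ∑ j ∈ Sᶜ, w i * P i j with hΦ
  have hΦ0 : 0 ≤ Φ := Finset.sum_nonneg fun i _ => Finset.sum_nonneg fun j _ =>
    mul_nonneg (hw i) (hP i j)
  rw [hgy', hg2] at hgy
  -- The two estimates combine to `59/64 * s * (1 - s) ≤ K / 2 * Φ`, and `1 - s ≥ 1/2`.
  have hmain : 59 / 64 * s ≤ K * Φ := by nlinarith
  have hnpos : (0 : ℝ) < n := by exact_mod_cast (by omega : 0 < n)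
  -- Since `δ ≤ 2`, rounding up costs at most `2 / δ`. The resulting constant `59 / (64 * 24)`
  -- exceeds `1/30`.
  have hmle : (m : ℝ) ≤ 8 / δ := by
    have h2 := (Nat.ceil_lt_add_one (by positivity : 0 ≤ 6 / δ)).le
    have h3 : 1 ≤ 2 / δ := by rwa [one_le_div hδ]
    calc (m : ℝ) ≤ 6 / δ + 1 := h2
      _ ≤ 6 / δ + 2 / δ := by linarith
      _ = 8 / δ := by ring
  have hKle : (K : ℝ) ≤ 24 * (n / δ) := by
    rw [hK]
    push_cast
    calc (m : ℝ) * (3 * n) ≤ 8 / δ * (3 * n) := by gcongr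
      _ = _ := by ring
  have hfin : 59 / 64 * s ≤ 24 * (n / δ) * Φ :=
    hmain.trans (mul_le_mul_of_nonneg_right hKle hΦ0)
  have hd : 0 < δ / n := by positivity
  have hmul := mul_le_mul_of_nonneg_left hfin hd.le
  have e3 : δ / n * (24 * (n / δ) * Φ) = 24 * Φ := by field_simp
  rw [e3] at hmul
  have := mul_nonneg hd.le hs0
  nlinarith

/-! ### Positivity of the eigenvectors -/

theorem IsLeftEigenvector.sum_mul_eq {n : ℕ} {R : Matrix (Fin n) (Fin n) ℝ} {u : Fin n → ℝ}
    (hu : IsLeftEigenvector R 1 u) (j : Fin n) : ∑ i, u i * R i j = u j := by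
  simpa [Matrix.vecMul, dotProduct] using congrFun hu.2 j

theorem IsRightEigenvector.sum_mul_eq {n : ℕ} {R : Matrix (Fin n) (Fin n) ℝ} {v : Fin n → ℝ}
    (hv : IsRightEigenvector R 1 v) (i : Fin n) : ∑ j, R i j * v j = v i := by
  simpa [Matrix.mulVec, dotProduct] using congrFun hv.2 i

/-- If `1` is a simple eigenvalue that strictly dominates the others in real part, then the spectral
projection onto its eigenspace is entrywise nonnegative. -/
theorem mul_nonneg_of_simple {n : ℕ} {R : Matrix (Fin n) (Fin n) ℝ} (hR : ∀ i j, 0 ≤ R i j)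
    (hPF : IsPFEigenvalue R 1) {u v : Fin n → ℝ} (hu : IsLeftEigenvector R 1 u)
    (hv : IsRightEigenvector R 1 v) (huv : u ⬝ᵥ v = 1) {z : ℂ} (hz : IsSecondEigenvalue R z)
    (hz1 : z.re < 1) (i j : Fin n) : 0 ≤ u j * v i := by
  have hsimple : (1 : ℂ) ∉ (eigenvalues R).erase 1 := by
    intro hmem
    have := hz.2 1 hmem
    simp only [Complex.one_re] at this
    linarith
  have hinv := weightedSum_complexEnd hu.sum_mul_eq
  have huv' : weightedSum u (fun i => (v i : ℂ)) = 1 := by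
    rw [weightedSum_apply]
    exact_mod_cast congrArg Complex.ofReal huv
  have hv' : complexEnd R (fun i => (v i : ℂ)) = fun i => (v i : ℂ) := by
    ext i
    rw [complexEnd_apply]
    exact_mod_cast congrArg Complex.ofReal (hv.sum_mul_eq i)
  set T := aeval (complexEnd R) lazyPoly with hT
  have hTv : ∀ k : ℕ, (T ^ k) (fun i => (v i : ℂ)) = fun i => (v i : ℂ) := by
    intro k
    induction k with
    | zero => simp
    | succ k ih =>
      rw [pow_succ', Module.End.mul_apply, ih, hT, aeval_lazyPoly_apply, hv', ← two_smul ℂ,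
        smul_smul]
      norm_num
  set e : Fin n → ℝ := Pi.single j 1 with he
  have he0 : ∀ i, 0 ≤ e i := fun i => by
    by_cases h : i = j
    · subst h; simp [he]
    · simp [he, h]
  -- A basis vector minus its spectral projection onto the line of `v`.
  set x : Fin n → ℂ := (fun i => (e i : ℂ)) - (u j : ℂ) • fun i => (v i : ℂ) with hx
  have hφx : weightedSum u x = 0 := by
    rw [hx, map_sub, map_smul, huv', weightedSum_apply, Finset.sum_eq_single j]
    · simp [he]
    · intro b _ hb
      simp [he, hb]
    · simp
  have hannih : ((((eigenvalues R).erase 1).toList.map fun μ => lazyPoly.eval μ).map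
      fun μ => T - algebraMap ℂ (Module.End ℂ (Fin n → ℂ)) μ).prod x = 0 := by
    apply prod_aeval_sub_apply_eq_zero
    have h1 : (1 : ℂ) ∈ eigenvalues R := by simpa using hPF.2.1
    rw [eigenvalues_eq_roots_charpoly_complexEnd] at *
    exact aeval_prod_erase_apply_eq_zero (complexEnd R) (weightedSum u) hinv hv'
      (by rw [huv']; exact one_ne_zero) h1 hsimple hφx
  set b := Real.sqrt (1 - (1 - z.re) / 2) with hb
  have hb0 : 0 ≤ b := Real.sqrt_nonneg _
  have hb1 : b < 1 := by
    rw [hb, Real.sqrt_lt' one_pos]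
    linarith
  have hsmall : ∀ ν ∈ ((eigenvalues R).erase 1).toList.map fun μ => lazyPoly.eval μ,
      ‖ν‖ ≤ b := by
    intro ν hν
    obtain ⟨μ, hμ, rfl⟩ := List.mem_map.1 hν
    rw [Multiset.mem_toList] at hμ
    have h2 := norm_eval_lazyPoly_sq_le (hPF.2.2 μ (Multiset.mem_of_mem_erase hμ))
    have h3 := hz.2 μ hμ
    exact Real.le_sqrt_of_sq_le (by linarith)
  set A := ‖LinearMap.toContinuousLinearMap T‖ with hA
  have hAT : ∀ y, normSeminorm ℂ (Fin n → ℂ) (T y) ≤ A * normSeminorm ℂ (Fin n → ℂ) y :=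
    fun y => (LinearMap.toContinuousLinearMap T).le_opNorm y
  set r := (1 + b) / 2 with hr
  -- No uniformity is needed here: `D` is simply large enough for the recursion with the rate `r`
  -- halfway between `b` and `1`.
  set D := max 1 ((A + b) / (r - b)) with hD
  have hrb : 0 < r - b := by rw [hr]; linarith
  have hDr : b * D + (A + b) ≤ D * r := by
    have := (div_le_iff₀ hrb).1 (le_max_right 1 ((A + b) / (r - b)))
    rw [← hD] at this
    linarith
  have hdecay := seminorm_pow_le_of_prod_eq_zero (normSeminorm ℂ (Fin n → ℂ)) T hb0
    (by rw [hr]; linarith) (le_max_left _ _) hAT hDr _ hsmall x hannih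
  set L := D ^ (((eigenvalues R).erase 1).toList.map fun μ => lazyPoly.eval μ).length
  -- The lazy iterates of a basis vector are nonnegative and differ from `u j * v i` by a vanishing
  -- error.
  have hlow : ∀ k : ℕ, -(L * r ^ k * ‖x‖) ≤ u j * v i := by
    intro k
    have h1 := (norm_le_pi_norm ((T ^ k) x) i).trans (hdecay k)
    have h2 : (T ^ k) x i = (((lazyStep R)^[k] e i - u j * v i : ℝ) : ℂ) := by
      rw [hx, map_sub, map_smul, hTv, hT, aeval_lazyPoly_pow_apply_ofReal]
      simp
    rw [h2, Complex.norm_real, Real.norm_eq_abs] at h1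
    have h3 := lazyStep_nonneg hR he0 k i
    have h4 := (le_abs_self _).trans h1
    simp only [coe_normSeminorm] at h4
    linarith
  have hlim : Filter.Tendsto (fun k : ℕ => -(L * r ^ k * ‖x‖)) Filter.atTop (nhds 0) := by
    have := ((tendsto_pow_atTop_nhds_zero_of_lt_one (r := r) (by rw [hr]; linarith)
      (by rw [hr]; linarith)).const_mul L).mul_const ‖x‖
    simpa using this.neg
  exact le_of_tendsto' hlim hlow

/-- All products `u j * v i` are nonnegative and nonzero, so every entry of `u` and `v` has the same
sign; if it is negative, negating both keeps the normalization. -/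
theorem exists_isPositivePair {n : ℕ} {R : Matrix (Fin n) (Fin n) ℝ} (hR : ∀ i j, 0 ≤ R i j)
    (hPF : IsPFEigenvalue R 1) {u v : Fin n → ℝ} (hu : IsLeftEigenvector R 1 u)
    (hv : IsRightEigenvector R 1 v) (huv : u ⬝ᵥ v = 1) (hpos : ∀ i, 0 < u i * v i) {z : ℂ}
    (hz : IsSecondEigenvalue R z) (hz1 : z.re < 1) :
    ∃ p : (Fin n → ℝ) × (Fin n → ℝ), IsPositivePair R p.1 p.2 := by
  have hnn := mul_nonneg_of_simple hR hPF hu hv huv hz hz1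
  obtain ⟨i₀, -⟩ := Function.ne_iff.1 hu.1
  have hnz : ∀ i, u i ≠ 0 := fun i h => by simpa [h] using hpos i
  have hnz' : ∀ i, v i ≠ 0 := fun i h => by simpa [h] using hpos i
  have hstrict : ∀ i j, 0 < u j * v i := fun i j =>
    lt_of_le_of_ne (hnn i j) (mul_ne_zero (hnz j) (hnz' i)).symm
  rcases lt_or_gt_of_ne (hnz i₀) with h | h
  · have hv0 : ∀ i, v i < 0 := fun i => neg_of_mul_pos_right (hstrict i i₀) h.le
    have hu0 : ∀ i, u i < 0 := fun i => neg_of_mul_pos_left (hstrict i₀ i) (hv0 i₀).le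
    refine ⟨(-u, -v), ⟨neg_ne_zero.2 hu.1, ?_⟩, ⟨neg_ne_zero.2 hv.1, ?_⟩,
      fun i => neg_pos.2 (hu0 i), fun i => neg_pos.2 (hv0 i), ?_⟩
    · rw [Matrix.neg_vecMul, hu.2, smul_neg]
    · rw [Matrix.mulVec_neg, hv.2, smul_neg]
    · simpa using huv
  · have hv0 : ∀ i, 0 < v i := fun i => pos_of_mul_pos_right (hstrict i i₀) h.le
    have hu0 : ∀ i, 0 < u i := fun i => pos_of_mul_pos_left (hstrict i₀ i) (hv0 i₀).le
    exact ⟨(u, v), hu, hv, hu0, hv0, huv⟩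

/-! ### Reduction to stochastic matrices -/

/-- The stochastic matrix similar to `R` through the diagonal matrix of a right eigenvector. -/
noncomputable def stochasticConj {n : ℕ} (R : Matrix (Fin n) (Fin n) ℝ) (y : Fin n → ℝ) :
    Matrix (Fin n) (Fin n) ℝ :=
  Matrix.of fun i j => (y i)⁻¹ * R i j * y j

theorem eigenvalues_stochasticConj {n : ℕ} (R : Matrix (Fin n) (Fin n) ℝ) {y : Fin n → ℝ}
    (hy : ∀ i, y i ≠ 0) : eigenvalues (stochasticConj R y) = eigenvalues R := by
  let D : (Matrix (Fin n) (Fin n) ℝ)ˣ :=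
    ⟨Matrix.diagonal y, Matrix.diagonal fun i => (y i)⁻¹,
      by simp [Matrix.diagonal_mul_diagonal, hy], by simp [Matrix.diagonal_mul_diagonal, hy]⟩
  have h : stochasticConj R y = D⁻¹.val * R * D.val := by
    ext i j
    change _ = (Matrix.diagonal (fun i => (y i)⁻¹) * R * Matrix.diagonal y) i j
    rw [Matrix.mul_diagonal, Matrix.diagonal_mul]
    rfl
  rw [eigenvalues, eigenvalues, Matrix.charpoly_map, Matrix.charpoly_map, h,
    Matrix.coe_units_inv, Matrix.charpoly_units_conj']

namespace IsPositivePair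

variable {n : ℕ} {R : Matrix (Fin n) (Fin n) ℝ} {x y : Fin n → ℝ}

theorem weight_pos (h : IsPositivePair R x y) (i : Fin n) : 0 < x i * y i :=
  mul_pos (h.2.2.1 i) (h.2.2.2.1 i)

theorem sum_weight (h : IsPositivePair R x y) : ∑ i, x i * y i = 1 := h.2.2.2.2

theorem stochasticConj_nonneg (h : IsPositivePair R x y) (hR : ∀ i j, 0 ≤ R i j) (i j : Fin n) :
    0 ≤ stochasticConj R y i j :=
  mul_nonneg (mul_nonneg (inv_nonneg.2 (h.2.2.2.1 i).le) (hR i j)) (h.2.2.2.1 j).le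

theorem sum_stochasticConj (h : IsPositivePair R x y) (i : Fin n) :
    ∑ j, stochasticConj R y i j = 1 := by
  simp only [stochasticConj, Matrix.of_apply, mul_assoc]
  rw [← Finset.mul_sum, h.2.1.sum_mul_eq, inv_mul_cancel₀ (h.2.2.2.1 i).ne']

theorem weight_mul_stochasticConj (h : IsPositivePair R x y) (i j : Fin n) :
    x i * y i * stochasticConj R y i j = R i j * x i * y j := by
  have := (h.2.2.2.1 i).ne'
  simp only [stochasticConj, Matrix.of_apply]
  field_simp

theorem stationary (h : IsPositivePair R x y) (j : Fin n) :
    ∑ i, x i * y i * stochasticConj R y i j = x j * y j := by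
  simp_rw [h.weight_mul_stochasticConj]
  rw [← Finset.sum_mul, ← h.1.sum_mul_eq j]
  simp_rw [mul_comm (R _ _)]

theorem eigenvalues_stochasticConj_eq (h : IsPositivePair R x y) :
    eigenvalues (stochasticConj R y) = eigenvalues R :=
  eigenvalues_stochasticConj R fun i => (h.2.2.2.1 i).ne'

theorem sum_weight_pos (h : IsPositivePair R x y) {S : Finset (Fin n)} (hS : S.Nonempty) :
    0 < ∑ i ∈ S, x i * y i :=
  Finset.sum_pos (fun i _ => h.weight_pos i) hS

theorem cutExpansion_nonneg (h : IsPositivePair R x y) (hR : ∀ i j, 0 ≤ R i j)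
    (S : Finset (Fin n)) : 0 ≤ cutExpansion R x y S :=
  div_nonneg (Finset.sum_nonneg fun i _ => Finset.sum_nonneg fun j _ =>
    mul_nonneg (mul_nonneg (hR i j) (h.2.2.1 i).le) (h.2.2.2.1 j).le)
    (Finset.sum_nonneg fun i _ => (h.weight_pos i).le)

/-- Two indices cannot both carry weight above `1/2`. Without a small cut the real infimum would
default to `0` and the lower bound could fail. -/
theorem exists_isSmallCut (h : IsPositivePair R x y) (hn : 2 ≤ n) :
    ∃ S, IsSmallCut x y S := by
  by_contra! hcon
  have hbig : ∀ i, 1 / 2 < x i * y i := fun i => by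
    by_contra hi
    exact hcon {i} ⟨Finset.singleton_nonempty i, by simpa using hi⟩
  have h1 := h.sum_weight
  have h3 := Finset.sum_lt_sum_of_nonempty (s := Finset.univ) ⟨⟨0, by omega⟩, Finset.mem_univ _⟩
    fun i _ => hbig i
  rw [h1, Finset.sum_const, Finset.card_univ, Fintype.card_fin, nsmul_eq_mul] at h3
  have : (2 : ℝ) ≤ n := by exact_mod_cast hn
  linarith

end IsPositivePair

theorem edgeExpansion_eq_iInf {n : ℕ} {R : Matrix (Fin n) (Fin n) ℝ}
    (h : ∃ p : (Fin n → ℝ) × (Fin n → ℝ), IsPositivePair R p.1 p.2) :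
    ∃ x y, IsPositivePair R x y ∧
      edgeExpansion R = ⨅ S : {S : Finset (Fin n) // IsSmallCut x y S}, cutExpansion R x y S :=
  ⟨h.choose.1, h.choose.2, h.choose_spec, by rw [edgeExpansion, dif_pos h]⟩

theorem edgeExpansion_nonneg {n : ℕ} {R : Matrix (Fin n) (Fin n) ℝ} (hR : ∀ i j, 0 ≤ R i j) :
    0 ≤ edgeExpansion R := by
  by_cases h : ∃ p : (Fin n → ℝ) × (Fin n → ℝ), IsPositivePair R p.1 p.2
  · obtain ⟨x, y, hxy, heq⟩ := edgeExpansion_eq_iInf h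
    rw [heq]
    exact Real.iInf_nonneg fun S => hxy.cutExpansion_nonneg hR S
  · rw [edgeExpansion, dif_neg h]

theorem edgeExpansion_le_sqrt {n : ℕ} {R : Matrix (Fin n) (Fin n) ℝ} (hR : ∀ i j, 0 ≤ R i j)
    {z : ℂ} (hz : z ∈ (eigenvalues R).erase 1) :
    edgeExpansion R ≤ Real.sqrt (2 * (1 - z.re)) := by
  by_cases h : ∃ p : (Fin n → ℝ) × (Fin n → ℝ), IsPositivePair R p.1 p.2
  · obtain ⟨x, y, hxy, heq⟩ := edgeExpansion_eq_iInf h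
    refine Real.le_sqrt_of_sq_le (sq_expansion_le_of_stochastic (P := stochasticConj R y)
      (hxy.stochasticConj_nonneg hR) hxy.sum_stochasticConj hxy.weight_pos hxy.stationary
      hxy.sum_weight (edgeExpansion_nonneg hR) (fun S hS hS2 => ?_)
      (by rwa [hxy.eigenvalues_stochasticConj_eq]))
    simp_rw [hxy.weight_mul_stochasticConj]
    rw [← le_div_iff₀ (hxy.sum_weight_pos hS), heq]
    exact ciInf_le ⟨0, by
      rintro _ ⟨S, rfl⟩
      exact hxy.cutExpansion_nonneg hR S⟩
      (⟨S, hS, hS2⟩ : {S : Finset (Fin n) // IsSmallCut x y S})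
  · rw [edgeExpansion, dif_neg h]
    exact Real.sqrt_nonneg _

theorem spectral_gap_le_edgeExpansion {n : ℕ} {R : Matrix (Fin n) (Fin n) ℝ}
    (hR : ∀ i j, 0 ≤ R i j) (hPF : IsPFEigenvalue R 1)
    (h : ∃ p : (Fin n → ℝ) × (Fin n → ℝ), IsPositivePair R p.1 p.2) {z : ℂ}
    (hz : IsSecondEigenvalue R z) (hz1 : z.re < 1) :
    1 / 30 * ((1 - z.re) / n) ≤ edgeExpansion R := by
  obtain ⟨x, y, hxy, heq⟩ := edgeExpansion_eq_iInf h
  have h1 : (1 : ℂ) ∈ eigenvalues R := by simpa using hPF.2.1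
  have hn : 2 ≤ n := by
    have h2 := Multiset.card_pos_iff_exists_mem.2 ⟨z, hz.1⟩
    rw [Multiset.card_erase_of_mem h1, card_eigenvalues] at h2
    have := Nat.pred_eq_sub_one (n := n)
    omega
  obtain ⟨S₀, hS₀⟩ := hxy.exists_isSmallCut hn
  have : Nonempty {S : Finset (Fin n) // IsSmallCut x y S} := ⟨⟨S₀, hS₀⟩⟩
  rw [heq]
  refine le_ciInf fun ⟨S, hS, hS2⟩ => ?_
  rw [cutExpansion, le_div_iff₀ (hxy.sum_weight_pos hS)]
  simp_rw [← hxy.weight_mul_stochasticConj]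
  have habs := (abs_le.1 ((Complex.abs_re_le_norm z).trans
    (hPF.2.2 z (Multiset.mem_of_mem_erase hz.1)))).1
  refine spectral_gap_mul_le_expansion hn (hxy.stochasticConj_nonneg hR)
    hxy.sum_stochasticConj (fun i => (hxy.weight_pos i).le) hxy.stationary hxy.sum_weight
    (by linarith) (by linarith) ?_ ?_ ?_ S hS2
  · rwa [hxy.eigenvalues_stochasticConj_eq]
  · rw [hxy.eigenvalues_stochasticConj_eq]
    exact hPF.2.2
  · rw [hxy.eigenvalues_stochasticConj_eq]
    intro μ hμ
    linarith [hz.2 μ hμ]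

end NonnegMatrix

/-! ### The main theorem -/

theorem theorem1p5 {n : ℕ} (R : Matrix (Fin n) (Fin n) ℝ) (hR : ∀ i j, 0 ≤ R i j)
    (hPF : NonnegMatrix.IsPFEigenvalue R 1)
    (u v : Fin n → ℝ)
    (hu : NonnegMatrix.IsLeftEigenvector R 1 u)
    (hv : NonnegMatrix.IsRightEigenvector R 1 v)
    (κ : ℝ) (hκ : κ = ⨅ i, u i * v i)
    (hnorm : 0 < κ → dotProduct u v = 1)
    (lam₂ : ℂ) (hlam₂ : NonnegMatrix.IsSecondEigenvalue R lam₂) :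
    (0 < κ →
      1 / 30 * ((1 - lam₂.re) / ((n : ℝ) + Real.log (1 / κ))) ≤ NonnegMatrix.edgeExpansion R) ∧
    0 ≤ NonnegMatrix.edgeExpansion R ∧
    NonnegMatrix.edgeExpansion R ≤ Real.sqrt (2 * (1 - lam₂.re)) := by
  refine ⟨fun hκ0 => ?_, NonnegMatrix.edgeExpansion_nonneg hR,
    NonnegMatrix.edgeExpansion_le_sqrt hR hlam₂.1⟩
  have hre : lam₂.re ≤ 1 := (Complex.re_le_norm _).trans
    (hPF.2.2 _ (Multiset.mem_of_mem_erase hlam₂.1))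
  rcases hre.eq_or_lt with h1 | h1
  · rw [h1]
    simpa using NonnegMatrix.edgeExpansion_nonneg hR
  obtain ⟨i₀, -⟩ := Function.ne_iff.1 hu.1
  have hle : ∀ i, κ ≤ u i * v i := fun i => by
    rw [hκ]
    exact ciInf_le (Set.finite_range _).bddBelow i
  have hpos : ∀ i, 0 < u i * v i := fun i => hκ0.trans_le (hle i)
  have hκ1 : κ ≤ 1 := (hle i₀).trans (by
    rw [← hnorm hκ0]
    exact Finset.single_le_sum (f := fun i => u i * v i) (fun i _ => (hpos i).le)
      (Finset.mem_univ i₀))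
  have hlog : 0 ≤ Real.log (1 / κ) := Real.log_nonneg (by rwa [one_le_div hκ0])
  have hn : (0 : ℝ) < n := by exact_mod_cast i₀.pos
  -- The bound with `n` alone suffices: `κ ≤ 1` makes the logarithm nonnegative, so it only enlarges
  -- the denominator.
  refine le_trans ?_ (NonnegMatrix.spectral_gap_le_edgeExpansion hR hPF
    (NonnegMatrix.exists_isPositivePair hR hPF hu hv (hnorm hκ0) hpos hlam₂ h1) hlam₂ h1)
  have : 0 ≤ 1 - lam₂.re := by linarith
  gcongr
  linarith
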